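/- **Theorem (Noninterference for the Davies–Pfenning calculus with codiscrete booleans).** *The calculus.* Fix a collection of base ground types, each given by an arbitrary collection of constants (for example the booleans, with constants $\mathtt{tt},\mathtt{ff}$). The types are $$A,B ::= \mathsf{unit} \mid \mathsf{Bool}_\nabla \mid g \mid A\times B \mid A\to B \mid \Box A \qquad (g \text{ a base ground type}).$$ Judgements have the form $\Delta;\Gamma\vdash M:A$, where $\Delta$ is a context of modal variables and $\Gamma$ a context of ordinary variables. Both kinds of variables may be used as terms; $\mathsf{unit}$, $\times$ and $\to$ have the usual rules of the simply typed $\lambda$-calculus, acting on $\Gamma$. The remaining rules are: - if $\Delta;\cdot\vdash M:A$ then $\Delta;\Gamma\vdash \mathsf{box}\,M:\Box A$; if $\Delta;\Gamma\vdash M:\Box A$ and $\Delta,u:A;\Gamma\vdash N:B$ then $\Delta;\Gamma\vdash \mathsf{let\ box}\ u = M\ \mathsf{in}\ N:B$; - $\Delta;\Gamma\vdash c:g$ for each constant $c$ of $g$; if $\Delta;\Gamma\vdash M:g$ and $\Delta;\Gamma\vdash E_c:C$ for every constant $c$ of $g$, with $C$ any type, then $\Delta;\Gamma\vdash \mathsf{case}\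 M\ \mathsf{of}\ (c\mapsto E_c)_c:C$ (this is if–then–else when $g$ is the type of booleans); - $\Delta;\Gamma\vdash \mathtt{tt},\mathtt{ff}:\mathsf{Bool}_\nabla$; if $\Delta;\Gamma\vdash M:\mathsf{Bool}_\nabla$ and $\Delta;\Gamma\vdash E_1,E_0:C$, where $C$ is *codiscrete*, then $\Delta;\Gamma\vdash \mathsf{if}\ M\ \mathsf{then}\ E_1\ \mathsf{else}\ E_0:C$. The codiscrete types are the least class that contains $\mathsf{unit}$ and $\mathsf{Bool}_\nabla$, contains $A\times B$ whenever it contains $A$ and $B$, and contains $A\to B$ whenever it contains $B$. Equality $\Delta;\Gamma\vdash M=N:A$ is the least congruence on well-typed terms (closed under all term formers, including $\mathsf{box}$) that contains the computation rules: $\beta$ for functions, the two projections of a pair, $\mathsf{let\ box}\ u=\mathsf{box}\,M\ \mathsf{in}\ N = N[M/u]$, $\mathsf{case}\ c\ \mathsf{of}\ (c'\mapsto E_{c'})_{c'} = E_c$, $\mathsf{if}\ \mathtt{tt}\ \mathsf{then}\ E_1\ \mathsf{else}\ E_0=E_1$ and $\mathsf{if}\ \mathtt{ff}\ \mathsf{then}\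 E_1\ \mathsf{else}\ E_0=E_0$. (No $\eta$-rules or commuting conversions are assumed; an equality that is derived here also holds in every larger theory on the same terms.) A *ground type* is a type defined by a collection of constants along with elimination and computation rules, that is, a base ground type $g$ or $\mathsf{Bool}_\nabla$. *Statement.* Let $G$ be a ground type and let $\cdot\,;x:\mathsf{Bool}_\nabla\vdash M:\Box G$. Then for all closed terms $\vdash E,E':\mathsf{Bool}_\nabla$, $$\vdash M[E/x]=M[E'/x]:\Box G .$$ -/

import Mathlib

universe u v

namespace DaviesPfenning

/-- A collection of ground types, each of them given by its collection of constants.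
For example the ordinary booleans are a `G` with `Const G = Bool`, and the flat natural
numbers are a `G` with `Const G = ℕ`. -/
structure Signature where
  Ground : Type u
  Const : Ground → Type v

/-- Types of the calculus: unit, the codiscrete booleans `Bool_∇`, the ground types of the
signature, products, functions, and the modal types `□ A`. -/
inductive Ty (S : Signature.{u, v}) : Type u
  | unit : Ty S
  | boolNabla : Ty S
  | ground (g : S.Ground) : Ty S
  | prod (A B : Ty S) : Ty S
  | arr (A B : Ty S) : Ty S
  | box (A : Ty S) : Ty S

/-- The codiscrete types: unit and `Bool_∇` are codiscrete, a product of codiscrete types is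
codiscrete, and so is a function type with a codiscrete codomain. -/
inductive Codiscrete {S : Signature.{u, v}} : Ty S → Prop
  | unit : Codiscrete Ty.unit
  | boolNabla : Codiscrete Ty.boolNabla
  | prod {A B : Ty S} : Codiscrete A → Codiscrete B → Codiscrete (Ty.prod A B)
  | arr {A B : Ty S} : Codiscrete B → Codiscrete (Ty.arr A B)

/-- The types that are defined by a collection of constants along with elimination and
computation rules: the ground types of the signature, and also `Bool_∇`. -/
inductive IsGround {S : Signature.{u, v}} : Ty S → Prop
  | ground (g : S.Ground) : IsGround (Ty.ground g)
  | boolNabla : IsGround Ty.boolNabla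

/-- Contexts. The most recently bound variable is the head of the list. -/
abbrev Ctx (S : Signature.{u, v}) : Type u := List (Ty S)

/-- `Var Γ A` is the type of (de Bruijn) variables of type `A` in the context `Γ`. -/
inductive Var {S : Signature.{u, v}} : Ctx S → Ty S → Type u
  | zero {Γ : Ctx S} {A : Ty S} : Var (A :: Γ) A
  | succ {Γ : Ctx S} {A B : Ty S} : Var Γ A → Var (B :: Γ) A

/-- `Tm Δ Γ A` is the type of terms `M` with `Δ ; Γ ⊢ M : A`, where `Δ` is the context of modal
variables and `Γ` the context of ordinary variables. Each constructor is a typing rule. -/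
inductive Tm {S : Signature.{u, v}} : Ctx S → Ctx S → Ty S → Type (max u v)
  /-- use of a modal variable -/
  | mvar {Δ Γ : Ctx S} {A : Ty S} : Var Δ A → Tm Δ Γ A
  /-- use of an ordinary variable -/
  | var {Δ Γ : Ctx S} {A : Ty S} : Var Γ A → Tm Δ Γ A
  | star {Δ Γ : Ctx S} : Tm Δ Γ Ty.unit
  | pair {Δ Γ : Ctx S} {A B : Ty S} : Tm Δ Γ A → Tm Δ Γ B → Tm Δ Γ (Ty.prod A B)
  | fst {Δ Γ : Ctx S} {A B : Ty S} : Tm Δ Γ (Ty.prod A B) → Tm Δ Γ A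
  | snd {Δ Γ : Ctx S} {A B : Ty S} : Tm Δ Γ (Ty.prod A B) → Tm Δ Γ B
  | lam {Δ Γ : Ctx S} {A B : Ty S} : Tm Δ (A :: Γ) B → Tm Δ Γ (Ty.arr A B)
  | app {Δ Γ : Ctx S} {A B : Ty S} : Tm Δ Γ (Ty.arr A B) → Tm Δ Γ A → Tm Δ Γ B
  /-- `box M`, where `M` may use modal variables only -/
  | box {Δ Γ : Ctx S} {A : Ty S} : Tm Δ [] A → Tm Δ Γ (Ty.box A)
  /-- `let box u = M in N`, where `u` is bound in `N` as a modal variable -/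
  | letbox {Δ Γ : Ctx S} {A B : Ty S} : Tm Δ Γ (Ty.box A) → Tm (A :: Δ) Γ B → Tm Δ Γ B
  /-- a constant of a ground type -/
  | const {Δ Γ : Ctx S} {g : S.Ground} : S.Const g → Tm Δ Γ (Ty.ground g)
  /-- elimination of a ground type into any type, with one branch for each constant -/
  | switch {Δ Γ : Ctx S} {g : S.Ground} {C : Ty S} :
      Tm Δ Γ (Ty.ground g) → (S.Const g → Tm Δ Γ C) → Tm Δ Γ C
  | tt {Δ Γ : Ctx S} : Tm Δ Γ Ty.boolNabla
  | ff {Δ Γ : Ctx S} : Tm Δ Γ Ty.boolNabla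
  /-- `if M then E₁ else E₀` for `M : Bool_∇`, into a codiscrete type -/
  | ite {Δ Γ : Ctx S} {C : Ty S} (hC : Codiscrete C) :
      Tm Δ Γ Ty.boolNabla → Tm Δ Γ C → Tm Δ Γ C → Tm Δ Γ C

/-- A renaming of the variables of one context by variables of another one. -/
def Ren {S : Signature.{u, v}} (Γ Γ' : Ctx S) : Type u :=
  ∀ ⦃A : Ty S⦄, Var Γ A → Var Γ' A

/-- Extension of a renaming under a binder. -/
def Ren.lift {S : Signature.{u, v}} {Γ Γ' : Ctx S} (ρ : Ren Γ Γ') {B : Ty S} :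
    Ren (B :: Γ) (B :: Γ')
  | _, Var.zero => Var.zero
  | _, Var.succ x => Var.succ (ρ x)

/-- Simultaneous renaming of the modal variables (`δ`) and the ordinary variables (`ρ`). -/
def Tm.rename {S : Signature.{u, v}} : {Δ Γ Δ' Γ' : Ctx S} → {A : Ty S} →
    Ren Δ Δ' → Ren Γ Γ' → Tm Δ Γ A → Tm Δ' Γ' A
  | _, _, _, _, _, δ, _, .mvar x => .mvar (δ x)
  | _, _, _, _, _, _, ρ, .var x => .var (ρ x)
  | _, _, _, _, _, _, _, .star => .star
  | _, _, _, _, _, δ, ρ, .pair M N => .pair (M.rename δ ρ) (N.rename δ ρ)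
  | _, _, _, _, _, δ, ρ, .fst M => .fst (M.rename δ ρ)
  | _, _, _, _, _, δ, ρ, .snd M => .snd (M.rename δ ρ)
  | _, _, _, _, _, δ, ρ, .lam M => .lam (M.rename δ ρ.lift)
  | _, _, _, _, _, δ, ρ, .app M N => .app (M.rename δ ρ) (N.rename δ ρ)
  | _, _, _, _, _, δ, _, .box M => .box (M.rename δ (fun _ x => x))
  | _, _, _, _, _, δ, ρ, .letbox M N => .letbox (M.rename δ ρ) (N.rename δ.lift ρ)
  | _, _, _, _, _, _, _, .const c => .const c
  | _, _, _, _, _, δ, ρ, .switch M E => .switch (M.rename δ ρ) (fun c => (E c).rename δ ρ)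
  | _, _, _, _, _, _, _, .tt => .tt
  | _, _, _, _, _, _, _, .ff => .ff
  | _, _, _, _, _, δ, ρ, .ite hC M E₁ E₀ =>
      .ite hC (M.rename δ ρ) (E₁.rename δ ρ) (E₀.rename δ ρ)

/-- The unique renaming out of the empty context. -/
def Ren.empty {S : Signature.{u, v}} {Γ : Ctx S} : Ren [] Γ :=
  fun _ x => nomatch x

/-- `Sub Δ' Γ Γ'` is the type of substitutions for the variables in `Γ` by terms over `Δ' ; Γ'`.
Ordinary variables in `Γ` are replaced by means of a `Sub Δ' Γ Γ'`, and modal variables in `Δ` by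
means of a `Sub Δ' Δ []`: a term that replaces a modal variable has no free ordinary variables. -/
def Sub {S : Signature.{u, v}} (Δ' Γ Γ' : Ctx S) : Type (max u v) :=
  ∀ ⦃A : Ty S⦄, Var Γ A → Tm Δ' Γ' A

/-- Extension of an ordinary substitution under a binder of an ordinary variable. -/
def Sub.lift {S : Signature.{u, v}} {Δ' Γ Γ' : Ctx S} (σ : Sub Δ' Γ Γ') {B : Ty S} :
    Sub Δ' (B :: Γ) (B :: Γ')
  | _, Var.zero => Tm.var Var.zero
  | _, Var.succ x => (σ x).rename (fun _ y => y) (fun _ y => Var.succ y)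

/-- Weakening of a substitution by a modal variable. -/
def Sub.mweaken {S : Signature.{u, v}} {Δ' Γ Γ' : Ctx S} (σ : Sub Δ' Γ Γ') {B : Ty S} :
    Sub (B :: Δ') Γ Γ' :=
  fun _ x => (σ x).rename (fun _ y => Var.succ y) (fun _ y => y)

/-- Extension of a modal substitution under a binder of a modal variable. -/
def Sub.mlift {S : Signature.{u, v}} {Δ Δ' : Ctx S} (τ : Sub Δ' Δ []) {B : Ty S} :
    Sub (B :: Δ') (B :: Δ) []
  | _, Var.zero => Tm.mvar Var.zero
  | _, Var.succ x => (τ x).rename (fun _ y => Var.succ y) (fun _ y => y)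

/-- The unique substitution for the empty context. -/
def Sub.empty {S : Signature.{u, v}} {Δ' Γ' : Ctx S} : Sub Δ' [] Γ' :=
  fun _ x => nomatch x

/-- Simultaneous capture-avoiding substitution for the modal variables (`τ`) and for the
ordinary variables (`σ`). -/
def Tm.subst {S : Signature.{u, v}} : {Δ Γ Δ' Γ' : Ctx S} → {A : Ty S} →
    Sub Δ' Δ [] → Sub Δ' Γ Γ' → Tm Δ Γ A → Tm Δ' Γ' A
  | _, _, _, _, _, τ, _, .mvar x => (τ x).rename (fun _ y => y) Ren.empty
  | _, _, _, _, _, _, σ, .var x => σ x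
  | _, _, _, _, _, _, _, .star => .star
  | _, _, _, _, _, τ, σ, .pair M N => .pair (M.subst τ σ) (N.subst τ σ)
  | _, _, _, _, _, τ, σ, .fst M => .fst (M.subst τ σ)
  | _, _, _, _, _, τ, σ, .snd M => .snd (M.subst τ σ)
  | _, _, _, _, _, τ, σ, .lam M => .lam (M.subst τ σ.lift)
  | _, _, _, _, _, τ, σ, .app M N => .app (M.subst τ σ) (N.subst τ σ)
  | _, _, _, _, _, τ, _, .box M => .box (M.subst τ Sub.empty)
  | _, _, _, _, _, τ, σ, .letbox M N => .letbox (M.subst τ σ) (N.subst τ.mlift σ.mweaken)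
  | _, _, _, _, _, _, _, .const c => .const c
  | _, _, _, _, _, τ, σ, .switch M E => .switch (M.subst τ σ) (fun c => (E c).subst τ σ)
  | _, _, _, _, _, _, _, .tt => .tt
  | _, _, _, _, _, _, _, .ff => .ff
  | _, _, _, _, _, τ, σ, .ite hC M E₁ E₀ =>
      .ite hC (M.subst τ σ) (E₁.subst τ σ) (E₀.subst τ σ)

/-- The ordinary substitution that sends the last variable to `N` and fixes the other ones. -/
def Sub.single {S : Signature.{u, v}} {Δ Γ : Ctx S} {B : Ty S} (N : Tm Δ Γ B) :
    Sub Δ (B :: Γ) Γ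
  | _, Var.zero => N
  | _, Var.succ x => Tm.var x

/-- The modal substitution that sends the last modal variable to `N` and fixes the other ones. -/
def Sub.msingle {S : Signature.{u, v}} {Δ : Ctx S} {B : Ty S} (N : Tm Δ [] B) :
    Sub Δ (B :: Δ) []
  | _, Var.zero => N
  | _, Var.succ x => Tm.mvar x

/-- `M[N/x]` for the last ordinary variable `x`. -/
def Tm.inst {S : Signature.{u, v}} {Δ Γ : Ctx S} {A B : Ty S}
    (M : Tm Δ (B :: Γ) A) (N : Tm Δ Γ B) : Tm Δ Γ A :=
  M.subst (fun _ x => Tm.mvar x) (Sub.single N)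

/-- `M[N/u]` for the last modal variable `u`. -/
def Tm.minst {S : Signature.{u, v}} {Δ Γ : Ctx S} {A B : Ty S}
    (M : Tm (B :: Δ) Γ A) (N : Tm Δ [] B) : Tm Δ Γ A :=
  M.subst (Sub.msingle N) (fun _ x => Tm.var x)

/-- The equational theory: `DefEq M N`, for `M N : Tm Δ Γ A`, is the judgement
`Δ ; Γ ⊢ M = N : A`. It is the least congruence that contains the computation rules. -/
inductive DefEq {S : Signature.{u, v}} :
    {Δ Γ : Ctx S} → {A : Ty S} → Tm Δ Γ A → Tm Δ Γ A → Prop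
  | refl {Δ Γ : Ctx S} {A : Ty S} (M : Tm Δ Γ A) : DefEq M M
  | symm {Δ Γ : Ctx S} {A : Ty S} {M N : Tm Δ Γ A} : DefEq M N → DefEq N M
  | trans {Δ Γ : Ctx S} {A : Ty S} {M N P : Tm Δ Γ A} : DefEq M N → DefEq N P → DefEq M P
  | pair {Δ Γ : Ctx S} {A B : Ty S} {M M' : Tm Δ Γ A} {N N' : Tm Δ Γ B} :
      DefEq M M' → DefEq N N' → DefEq (Tm.pair M N) (Tm.pair M' N')
  | fst {Δ Γ : Ctx S} {A B : Ty S} {M M' : Tm Δ Γ (Ty.prod A B)} :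
      DefEq M M' → DefEq (Tm.fst M) (Tm.fst M')
  | snd {Δ Γ : Ctx S} {A B : Ty S} {M M' : Tm Δ Γ (Ty.prod A B)} :
      DefEq M M' → DefEq (Tm.snd M) (Tm.snd M')
  | lam {Δ Γ : Ctx S} {A B : Ty S} {M M' : Tm Δ (A :: Γ) B} :
      DefEq M M' → DefEq (Tm.lam M) (Tm.lam M')
  | app {Δ Γ : Ctx S} {A B : Ty S} {M M' : Tm Δ Γ (Ty.arr A B)} {N N' : Tm Δ Γ A} :
      DefEq M M' → DefEq N N' → DefEq (Tm.app M N) (Tm.app M' N')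
  | box {Δ Γ : Ctx S} {A : Ty S} {M M' : Tm Δ [] A} :
      DefEq M M' → DefEq (Tm.box (Γ := Γ) M) (Tm.box (Γ := Γ) M')
  | letbox {Δ Γ : Ctx S} {A B : Ty S} {M M' : Tm Δ Γ (Ty.box A)} {N N' : Tm (A :: Δ) Γ B} :
      DefEq M M' → DefEq N N' → DefEq (Tm.letbox M N) (Tm.letbox M' N')
  | switch {Δ Γ : Ctx S} {g : S.Ground} {C : Ty S} {M M' : Tm Δ Γ (Ty.ground g)}
      {E E' : S.Const g → Tm Δ Γ C} :
      DefEq M M' → (∀ c, DefEq (E c) (E' c)) → DefEq (Tm.switch M E) (Tm.switch M' E')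
  | ite {Δ Γ : Ctx S} {C : Ty S} (hC : Codiscrete C) {M M' : Tm Δ Γ Ty.boolNabla}
      {E₁ E₁' E₀ E₀' : Tm Δ Γ C} :
      DefEq M M' → DefEq E₁ E₁' → DefEq E₀ E₀' →
        DefEq (Tm.ite hC M E₁ E₀) (Tm.ite hC M' E₁' E₀')
  | fst_pair {Δ Γ : Ctx S} {A B : Ty S} (M : Tm Δ Γ A) (N : Tm Δ Γ B) :
      DefEq (Tm.fst (Tm.pair M N)) M
  | snd_pair {Δ Γ : Ctx S} {A B : Ty S} (M : Tm Δ Γ A) (N : Tm Δ Γ B) :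
      DefEq (Tm.snd (Tm.pair M N)) N
  | app_lam {Δ Γ : Ctx S} {A B : Ty S} (M : Tm Δ (A :: Γ) B) (N : Tm Δ Γ A) :
      DefEq (Tm.app (Tm.lam M) N) (M.inst N)
  | letbox_box {Δ Γ : Ctx S} {A B : Ty S} (M : Tm Δ [] A) (N : Tm (A :: Δ) Γ B) :
      DefEq (Tm.letbox (Tm.box M) N) (N.minst M)
  | switch_const {Δ Γ : Ctx S} {g : S.Ground} {C : Ty S} (c : S.Const g)
      (E : S.Const g → Tm Δ Γ C) : DefEq (Tm.switch (Tm.const c) E) (E c)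
  | ite_tt {Δ Γ : Ctx S} {C : Ty S} (hC : Codiscrete C) (E₁ E₀ : Tm Δ Γ C) :
      DefEq (Tm.ite hC Tm.tt E₁ E₀) E₁
  | ite_ff {Δ Γ : Ctx S} {C : Ty S} (hC : Codiscrete C) (E₁ E₀ : Tm Δ Γ C) :
      DefEq (Tm.ite hC Tm.ff E₁ E₀) E₀

end DaviesPfenning

/-! The proof is a binary logical relation `Related` on closed terms, total at `Bool_∇`. Its value
at `□ A` is chosen so that relatedness already yields the desired equality: both terms equal one and
the same box. The fundamental lemma `Tm.related_subst` lets the two sides differ only in the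
ordinary substitution and shares the modal one. A boxed body has no ordinary variables, so it comes
out identical on both sides; `let box` then extends the shared modal substitution by that common
body. The eliminator of `Bool_∇` is harmless because it lands in codiscrete types, where the
relation is again total (`Codiscrete.related`). Any two closed `E`, `E'` are related, so the two
instances of `M` equal a common box. The syntactic part supplies the substitution laws needed for
the two `β`-like rules. -/

namespace DaviesPfenning

variable {S : Signature.{u, v}}

/-! ### Renamings -/

/-- The identity renaming. -/
def Ren.id {Γ : Ctx S} : Ren Γ Γ := fun _ x => x

/-- The weakening renaming. -/
def Ren.wk {Γ : Ctx S} {B : Ty S} : Ren Γ (B :: Γ) := fun _ x => x.succ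

/-- Composition of renamings, in diagrammatic order. -/
def Ren.comp {Γ Γ' Γ'' : Ctx S} (ρ : Ren Γ Γ') (ρ' : Ren Γ' Γ'') : Ren Γ Γ'' :=
  fun _ x => ρ' (ρ x)

theorem Ren.eq_empty {Γ : Ctx S} (ρ : Ren [] Γ) : ρ = Ren.empty := by
  funext A x; nomatch x

theorem Ren.lift_id {Γ : Ctx S} {B : Ty S} : (Ren.id (Γ := Γ)).lift (B := B) = Ren.id := by
  funext A x; cases x <;> rfl

theorem Ren.lift_comp_lift {Γ Γ' Γ'' : Ctx S} (ρ : Ren Γ Γ') (ρ' : Ren Γ' Γ'') {B : Ty S} :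
    (ρ.lift (B := B)).comp ρ'.lift = (ρ.comp ρ').lift := by
  funext A x; cases x <;> rfl

/-- Folds the literal identity function of the definition into `Ren.id`, the form in which later
rewrites expect it. -/
theorem Tm.rename_box {Δ Γ Δ' Γ' : Ctx S} {A : Ty S} (δ : Ren Δ Δ') (ρ : Ren Γ Γ')
    (M : Tm Δ [] A) : (Tm.box M).rename δ ρ = Tm.box (M.rename δ Ren.id) := by
  rw [Tm.rename]; rfl

theorem Tm.rename_id {Δ Γ : Ctx S} {A : Ty S} (M : Tm Δ Γ A) :
    M.rename Ren.id Ren.id = M := by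
  induction M with
  | box M ih => rw [Tm.rename_box, ih]
  | mvar x => rfl
  | var x => rfl
  | _ => simp_all [Tm.rename, Ren.lift_id]

theorem Tm.rename_rename {Δ Γ : Ctx S} {A : Ty S} (M : Tm Δ Γ A) :
    ∀ {Δ' Γ' Δ'' Γ'' : Ctx S} (δ : Ren Δ Δ') (ρ : Ren Γ Γ') (δ' : Ren Δ' Δ'') (ρ' : Ren Γ' Γ''),
      (M.rename δ ρ).rename δ' ρ' = M.rename (δ.comp δ') (ρ.comp ρ') := by
  induction M with
  | box M ih => intros; simp only [Tm.rename_box, ih]; rfl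
  | mvar x => intros; rfl
  | var x => intros; rfl
  | _ => intros; simp_all [Tm.rename, Ren.lift_comp_lift]

/-! ### Substitutions -/

/-- The identity substitution of ordinary variables. -/
def Sub.id {Δ Γ : Ctx S} : Sub Δ Γ Γ := fun _ x => Tm.var x

/-- The identity substitution of modal variables. -/
def Sub.mid {Δ : Ctx S} : Sub Δ Δ [] := fun _ x => Tm.mvar x

/-- Extension of a substitution by a term for the last variable. -/
def Sub.cons {Δ Γ Γ' : Ctx S} (σ : Sub Δ Γ Γ') {B : Ty S} (N : Tm Δ Γ' B) : Sub Δ (B :: Γ) Γ'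
  | _, Var.zero => N
  | _, Var.succ x => σ x

/-- Precomposition of a substitution with a renaming. -/
def Sub.precomp {Δ Γ Γ' Γ'' : Ctx S} (ρ : Ren Γ Γ') (σ : Sub Δ Γ' Γ'') : Sub Δ Γ Γ'' :=
  fun _ x => σ (ρ x)

/-- Postcomposition of a substitution with a renaming. -/
def Sub.rename {Δ Δ' Γ Γ' Γ'' : Ctx S} (δ : Ren Δ Δ') (ρ : Ren Γ' Γ'') (σ : Sub Δ Γ Γ') :
    Sub Δ' Γ Γ'' :=
  fun _ x => (σ x).rename δ ρ

/-- Postcomposition of a substitution with a substitution. -/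
def Sub.subst {Δ Δ' Γ Γ' Γ'' : Ctx S} (σ : Sub Δ Γ Γ') (τ : Sub Δ' Δ []) (σ' : Sub Δ' Γ' Γ'') :
    Sub Δ' Γ Γ'' :=
  fun _ x => (σ x).subst τ σ'

/-- Passing under `box` resets the ordinary context to `[]`; this identifies the various composites
and identities that then arise. -/
theorem Sub.eq_empty {Δ Γ : Ctx S} (σ : Sub Δ [] Γ) : σ = Sub.empty := by
  funext A x; nomatch x

theorem Sub.rename_id {Δ Γ Γ' : Ctx S} (σ : Sub Δ Γ Γ') : σ.rename Ren.id Ren.id = σ := by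
  funext A x; exact Tm.rename_id _

theorem Sub.precomp_lift {Δ Γ Γ' Γ'' : Ctx S} (ρ : Ren Γ Γ') (σ : Sub Δ Γ' Γ'') {B : Ty S} :
    Sub.precomp (ρ.lift (B := B)) σ.lift = (Sub.precomp ρ σ).lift := by
  funext A x; cases x <;> rfl

theorem Sub.precomp_mlift {Δ Δ' Δ'' : Ctx S} (δ : Ren Δ Δ') (τ : Sub Δ'' Δ' []) {B : Ty S} :
    Sub.precomp (δ.lift (B := B)) τ.mlift = (Sub.precomp δ τ).mlift := by
  funext A x; cases x <;> rfl

theorem Tm.subst_mvar {Δ Γ Δ' Γ' : Ctx S} {A : Ty S} (τ : Sub Δ' Δ []) (σ : Sub Δ' Γ Γ')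
    (x : Var Δ A) : (Tm.mvar x).subst τ σ = (τ x).rename Ren.id Ren.empty := by
  rw [Tm.subst]; rfl

theorem Tm.subst_rename {Δ Γ : Ctx S} {A : Ty S} (M : Tm Δ Γ A) :
    ∀ {Δ' Γ' Δ'' Γ'' : Ctx S} (δ : Ren Δ Δ') (ρ : Ren Γ Γ') (τ : Sub Δ'' Δ' [])
      (σ : Sub Δ'' Γ' Γ''),
      (M.rename δ ρ).subst τ σ = M.subst (Sub.precomp δ τ) (Sub.precomp ρ σ) := by
  induction M with
  | box M ih => intros; simp only [Tm.rename_box, Tm.subst, ih]; rfl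
  | letbox M N ihM ihN =>
    intros; simp only [Tm.rename, Tm.subst, ihM, ihN, Sub.precomp_mlift]; rfl
  | mvar x => intros; rfl
  | var x => intros; rfl
  | _ => intros; simp_all [Tm.rename, Tm.subst, Sub.precomp_lift]

theorem Sub.rename_lift {Δ Δ' Γ Γ' Γ'' : Ctx S} (σ : Sub Δ Γ Γ') (δ : Ren Δ Δ') (ρ : Ren Γ' Γ'')
    {B : Ty S} : (σ.lift (B := B)).rename δ ρ.lift = (σ.rename δ ρ).lift := by
  funext A x
  cases x with
  | zero => rfl
  | succ x =>
    exact (Tm.rename_rename (σ x) Ren.id Ren.wk δ ρ.lift).trans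
      (Tm.rename_rename (σ x) δ ρ Ren.id Ren.wk).symm

theorem Sub.rename_mlift {Δ Δ' Δ'' : Ctx S} (τ : Sub Δ' Δ []) (δ : Ren Δ' Δ'') {B : Ty S} :
    (τ.mlift (B := B)).rename δ.lift Ren.id = Sub.mlift (τ.rename δ Ren.id) := by
  funext A x
  cases x with
  | zero => rfl
  | succ x =>
    exact (Tm.rename_rename (τ x) Ren.wk Ren.id δ.lift Ren.id).trans
      (Tm.rename_rename (τ x) δ Ren.id Ren.wk Ren.id).symm

theorem Sub.rename_mweaken {Δ Δ' Γ Γ' Γ'' : Ctx S} (σ : Sub Δ Γ Γ') (δ : Ren Δ Δ')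
    (ρ : Ren Γ' Γ'') {B : Ty S} :
    (σ.mweaken (B := B)).rename δ.lift ρ = (σ.rename δ ρ).mweaken := by
  funext A x
  exact (Tm.rename_rename (σ x) Ren.wk Ren.id δ.lift ρ).trans
    (Tm.rename_rename (σ x) δ ρ Ren.wk Ren.id).symm

theorem Tm.rename_subst {Δ Γ : Ctx S} {A : Ty S} (M : Tm Δ Γ A) :
    ∀ {Δ' Γ' Δ'' Γ'' : Ctx S} (τ : Sub Δ' Δ []) (σ : Sub Δ' Γ Γ') (δ : Ren Δ' Δ'')
      (ρ : Ren Γ' Γ''),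
      (M.subst τ σ).rename δ ρ = M.subst (τ.rename δ Ren.id) (σ.rename δ ρ) := by
  induction M with
  | mvar x =>
    intro _ _ _ _ τ σ δ ρ
    simp only [Tm.subst_mvar, Sub.rename, Tm.rename_rename]
    -- Terms replacing modal variables live over an empty ordinary context, so `ρ` cannot affect
    -- them.
    rw [Ren.eq_empty (Ren.comp _ _), Ren.eq_empty (Ren.comp _ _)]
    rfl
  | box M ih =>
    intros
    simp only [Tm.rename_box, Tm.subst, ih]
    rw [Sub.eq_empty (Sub.rename _ _ _)]
  | letbox M N ihM ihN =>
    intros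
    simp only [Tm.rename, Tm.subst, ihM, ihN, Sub.rename_mlift, Sub.rename_mweaken]
  | lam M ih => intros; simp only [Tm.rename, Tm.subst, ih, Sub.rename_lift]
  | var x => intros; rfl
  | _ => intros; simp_all [Tm.rename, Tm.subst]

/-- On old variables both sides reduce to a weakening of `σ x`, moved past the substitution by the
two mixed laws for renaming and substitution. -/
theorem Sub.subst_lift {Δ Δ' Γ Γ' Γ'' : Ctx S} (σ : Sub Δ Γ Γ') (τ : Sub Δ' Δ [])
    (σ' : Sub Δ' Γ' Γ'') {B : Ty S} :
    (σ.lift (B := B)).subst τ σ'.lift = (σ.subst τ σ').lift := by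
  funext A x
  cases x with
  | zero => rfl
  | succ x =>
    refine (Tm.subst_rename (σ x) Ren.id Ren.wk τ σ'.lift).trans
      (Eq.trans ?_ (Tm.rename_subst (σ x) τ σ' Ren.id Ren.wk).symm)
    rw [Sub.rename_id]; rfl

theorem Sub.subst_mlift {Δ Δ' Δ'' : Ctx S} (τ : Sub Δ' Δ []) (τ' : Sub Δ'' Δ' []) {B : Ty S} :
    (τ.mlift (B := B)).subst τ'.mlift Sub.empty = Sub.mlift (τ.subst τ' Sub.empty) := by
  funext A x
  cases x with
  | zero => rfl
  | succ x =>
    refine (Tm.subst_rename (τ x) Ren.wk Ren.id τ'.mlift Sub.empty).trans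
      (Eq.trans ?_ (Tm.rename_subst (τ x) τ' Sub.empty Ren.wk Ren.id).symm)
    rw [Sub.eq_empty (Sub.rename Ren.wk Ren.id Sub.empty)]; rfl

theorem Sub.subst_mweaken {Δ Δ' Γ Γ' Γ'' : Ctx S} (σ : Sub Δ Γ Γ') (τ : Sub Δ' Δ [])
    (σ' : Sub Δ' Γ' Γ'') {B : Ty S} :
    (σ.mweaken (B := B)).subst τ.mlift σ'.mweaken = (σ.subst τ σ').mweaken := by
  funext A x
  exact (Tm.subst_rename (σ x) Ren.wk Ren.id τ.mlift σ'.mweaken).trans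
    (Tm.rename_subst (σ x) τ σ' Ren.wk Ren.id).symm

theorem Tm.subst_subst {Δ Γ : Ctx S} {A : Ty S} (M : Tm Δ Γ A) :
    ∀ {Δ' Γ' Δ'' Γ'' : Ctx S} (τ : Sub Δ' Δ []) (σ : Sub Δ' Γ Γ') (τ' : Sub Δ'' Δ' [])
      (σ' : Sub Δ'' Γ' Γ''),
      (M.subst τ σ).subst τ' σ' = M.subst (τ.subst τ' Sub.empty) (σ.subst τ' σ') := by
  induction M with
  | mvar x =>
    intro _ _ _ _ τ σ τ' σ'
    simp only [Tm.subst_mvar, Sub.subst, Tm.subst_rename, Tm.rename_subst]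
    rw [Sub.rename_id, Sub.eq_empty (Sub.precomp _ _), Sub.eq_empty (Sub.rename _ _ _)]
    rfl
  | box M ih =>
    intros
    simp only [Tm.subst, ih]
    rw [Sub.eq_empty (Sub.subst Sub.empty _ _)]
  | letbox M N ihM ihN =>
    intros
    simp only [Tm.subst, ihM, ihN, Sub.subst_mlift, Sub.subst_mweaken]
  | lam M ih => intros; simp only [Tm.subst, ih, Sub.subst_lift]
  | var x => intros; rfl
  | _ => intros; simp_all [Tm.subst]

theorem Sub.lift_id {Δ Γ : Ctx S} {B : Ty S} :
    (Sub.id (Δ := Δ) (Γ := Γ)).lift (B := B) = Sub.id := by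
  funext A x; cases x <;> rfl

theorem Sub.mlift_mid {Δ : Ctx S} {B : Ty S} :
    (Sub.mid (Δ := Δ)).mlift (B := B) = Sub.mid := by
  funext A x; cases x <;> rfl

theorem Sub.mweaken_id {Δ Γ : Ctx S} {B : Ty S} :
    (Sub.id (Δ := Δ) (Γ := Γ)).mweaken (B := B) = Sub.id := rfl

theorem Tm.subst_id {Δ Γ : Ctx S} {A : Ty S} (M : Tm Δ Γ A) :
    M.subst Sub.mid Sub.id = M := by
  induction M with
  | mvar x => rfl
  | var x => rfl
  | box M ih => rw [Tm.subst, ← Sub.eq_empty Sub.id, ih]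
  | _ => simp_all [Tm.subst, Sub.lift_id, Sub.mlift_mid, Sub.mweaken_id]

/-- Turns a `β`-reduct into a single simultaneous substitution, to which the induction hypothesis of
the fundamental lemma applies. -/
theorem Tm.inst_subst_lift {Δ Γ Δ' Γ' : Ctx S} {A B : Ty S} (τ : Sub Δ' Δ []) (σ : Sub Δ' Γ Γ')
    (M : Tm Δ (B :: Γ) A) (N : Tm Δ' Γ' B) :
    (M.subst τ σ.lift).inst N = M.subst τ (σ.cons N) := by
  have hτ : τ.subst Sub.mid Sub.empty = τ := by
    funext C x
    rw [← Sub.eq_empty Sub.id]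
    exact Tm.subst_id _
  have hσ : (σ.lift (B := B)).subst Sub.mid (Sub.single N) = σ.cons N := by
    funext C x
    cases x with
    | zero => rfl
    | succ x =>
      exact (Tm.subst_rename (σ x) Ren.id Ren.wk Sub.mid (Sub.single N)).trans (Tm.subst_id _)
  exact (Tm.subst_subst M τ σ.lift Sub.mid (Sub.single N)).trans (by rw [hτ, hσ])

/-- The same for `let box`: only the modal substitution grows, since instantiation cancels the
weakening of `σ`. -/
theorem Tm.minst_subst_mlift {Δ Γ Δ' Γ' : Ctx S} {A B : Ty S} (τ : Sub Δ' Δ [])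
    (σ : Sub Δ' Γ Γ') (M : Tm (B :: Δ) Γ A) (N : Tm Δ' [] B) :
    (M.subst τ.mlift σ.mweaken).minst N = M.subst (τ.cons N) σ := by
  have hτ : (τ.mlift (B := B)).subst (Sub.msingle N) Sub.empty = τ.cons N := by
    funext C x
    rw [← Sub.eq_empty Sub.id]
    cases x with
    | zero =>
      refine (Tm.subst_mvar (Sub.msingle N) Sub.id Var.zero).trans ?_
      rw [← Ren.eq_empty Ren.id, Tm.rename_id]; rfl
    | succ x =>
      exact (Tm.subst_rename (τ x) Ren.wk Ren.id (Sub.msingle N) Sub.id).trans (Tm.subst_id _)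
  have hσ : (σ.mweaken (B := B)).subst (Sub.msingle N) Sub.id = σ := by
    funext C x
    exact (Tm.subst_rename (σ x) Ren.wk Ren.id (Sub.msingle N) Sub.id).trans (Tm.subst_id _)
  exact (Tm.subst_subst M τ.mlift σ.mweaken (Sub.msingle N) Sub.id).trans (by rw [hτ, hσ])

/-! ### The logical relation -/

/-- Indistinguishability of closed terms. Closed terms of type `Bool_∇` are never distinguished,
and related terms of type `□ A` compute to the same boxed term. -/
def Related : (A : Ty S) → Tm [] [] A → Tm [] [] A → Prop
  | .unit, _, _ => True
  | .boolNabla, _, _ => True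
  | .ground _, M, M' => ∃ c, DefEq M (.const c) ∧ DefEq M' (.const c)
  | .prod A B, M, M' => Related A M.fst M'.fst ∧ Related B M.snd M'.snd
  | .arr A B, M, M' => ∀ N N', Related A N N' → Related B (M.app N) (M'.app N')
  -- Self-relatedness of `P` is what allows it to replace a modal variable.
  | .box A, M, M' => ∃ P, DefEq M (.box P) ∧ DefEq M' (.box P) ∧ Related A P P

theorem Codiscrete.related {A : Ty S} (hA : Codiscrete A) :
    ∀ M M' : Tm [] [] A, Related A M M' := by
  induction hA with
  | unit => exact fun _ _ => trivial
  | boolNabla => exact fun _ _ => trivial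
  | prod _ _ ihA ihB => exact fun _ _ => ⟨ihA _ _, ihB _ _⟩
  | arr _ ih => exact fun _ _ _ _ _ => ih _ _

/-- Transitivity settles the types with a witness, congruence of the eliminators the others. It
reduces each computation rule to its reduct. -/
theorem Related.of_defEq {A : Ty S} : ∀ {M M' N N' : Tm [] [] A}, DefEq M N → DefEq M' N' →
    Related A N N' → Related A M M' := by
  induction A with
  | unit => exact fun _ _ _ => trivial
  | boolNabla => exact fun _ _ _ => trivial
  | ground g => exact fun h h' ⟨c, hc, hc'⟩ => ⟨c, h.trans hc, h'.trans hc'⟩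
  | prod A B ihA ihB => exact fun h h' r => ⟨ihA h.fst h'.fst r.1, ihB h.snd h'.snd r.2⟩
  | arr A B _ ihB =>
    exact fun h h' r P P' hP => ihB (h.app (.refl P)) (h'.app (.refl P')) (r P P' hP)
  | box A _ => exact fun h h' ⟨P, hP, hP', r⟩ => ⟨P, h.trans hP, h'.trans hP', r⟩

/-- The fundamental lemma: related substitutions for the ordinary variables give related terms. -/
theorem Tm.related_subst {Δ Γ : Ctx S} {A : Ty S} (M : Tm Δ Γ A) :
    ∀ (τ : Sub [] Δ []) (σ σ' : Sub [] Γ []),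
      (∀ B (x : Var Δ B), Related B (τ x) (τ x)) →
      (∀ B (x : Var Γ B), Related B (σ x) (σ' x)) →
      Related A (M.subst τ σ) (M.subst τ σ') := by
  induction M with
  | mvar x =>
    intro τ σ σ' hτ _
    rw [Tm.subst_mvar, Tm.subst_mvar, ← Ren.eq_empty Ren.id, Tm.rename_id]
    exact hτ _ x
  | var x => exact fun τ σ σ' _ hσ => hσ _ x
  | star => exact fun _ _ _ _ _ => trivial
  | pair M N ihM ihN =>
    exact fun τ σ σ' hτ hσ =>
      ⟨.of_defEq (.fst_pair _ _) (.fst_pair _ _) (ihM τ σ σ' hτ hσ),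
        .of_defEq (.snd_pair _ _) (.snd_pair _ _) (ihN τ σ σ' hτ hσ)⟩
  | fst M ih => exact fun τ σ σ' hτ hσ => (ih τ σ σ' hτ hσ).1
  | snd M ih => exact fun τ σ σ' hτ hσ => (ih τ σ σ' hτ hσ).2
  | lam M ih =>
    intro τ σ σ' hτ hσ N N' hN
    refine .of_defEq (.app_lam _ _) (.app_lam _ _) ?_
    rw [Tm.inst_subst_lift, Tm.inst_subst_lift]
    refine ih τ _ _ hτ fun B x => ?_
    cases x with
    | zero => exact hN
    | succ x => exact hσ _ x
  | app M N ihM ihN =>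
    exact fun τ σ σ' hτ hσ => ihM τ σ σ' hτ hσ _ _ (ihN τ σ σ' hτ hσ)
  | box M ih =>
    exact fun τ _ _ hτ _ =>
      -- Neither `σ` nor `σ'` enters the body, so one witness serves both sides.
      ⟨M.subst τ Sub.empty, .refl _, .refl _, ih τ _ _ hτ (fun _ x => nomatch x)⟩
  | letbox M N ihM ihN =>
    intro τ σ σ' hτ hσ
    obtain ⟨P, hP, hP', hPP⟩ := ihM τ σ σ' hτ hσ
    refine .of_defEq ((DefEq.letbox hP (.refl _)).trans (.letbox_box _ _))
      ((DefEq.letbox hP' (.refl _)).trans (.letbox_box _ _)) ?_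
    rw [Tm.minst_subst_mlift, Tm.minst_subst_mlift]
    -- Because the two boxes share `P`, a single extended modal substitution suffices.
    refine ihN _ σ σ' (fun B x => ?_) hσ
    cases x with
    | zero => exact hPP
    | succ x => exact hτ _ x
  | const c => exact fun _ _ _ _ _ => ⟨c, .refl _, .refl _⟩
  | switch M E ihM ihE =>
    intro τ σ σ' hτ hσ
    -- Both scrutinees equal the same constant, so both sides select the branch at `c`.
    obtain ⟨c, hc, hc'⟩ := ihM τ σ σ' hτ hσ
    exact .of_defEq ((DefEq.switch hc fun _ => .refl _).trans (.switch_const c _))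
      ((DefEq.switch hc' fun _ => .refl _).trans (.switch_const c _)) (ihE c τ σ σ' hτ hσ)
  | tt => exact fun _ _ _ _ _ => trivial
  | ff => exact fun _ _ _ _ _ => trivial
  | ite hC => exact fun _ _ _ _ _ => hC.related _ _

end DaviesPfenning

theorem mainTheorem6 (S : DaviesPfenning.Signature.{u, v}) (G : DaviesPfenning.Ty S)
    (hG : DaviesPfenning.IsGround G)
    (M : DaviesPfenning.Tm [] [DaviesPfenning.Ty.boolNabla] (DaviesPfenning.Ty.box G))
    (E E' : DaviesPfenning.Tm [] [] (DaviesPfenning.Ty.boolNabla (S := S))) :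
    DaviesPfenning.DefEq (M.inst E) (M.inst E') := by
  -- The relation at `Bool_∇` is total, so the substitutions by `E` and `E'` are related outright.
  obtain ⟨P, hP, hP', -⟩ := M.related_subst DaviesPfenning.Sub.mid
    (DaviesPfenning.Sub.single E) (DaviesPfenning.Sub.single E') (fun _ x => nomatch x) (by
      intro B x
      cases x with
      | zero => trivial
      | succ x => nomatch x)
  exact hP.trans hP'.symm
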